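/- Let $G$ be a finite simple graph with vertex set $\{1,\dots,n\}$ and edge set $E$, let $R=\mathbb{C}[x_1,\dots,x_n]$, and let $\mathcal{A}(G)$ be its graphic arrangement, consisting of the linear forms $f_e=x_i-x_j$, one for each edge $e=\{i,j\}\in E$ with $i<j$. The likelihood module of $\mathcal{A}(G)$ is $M(\mathcal{A}(G))=R^{E}/L$, where $L$ is the submodule of all $a\in R^{E}$ for which there exists $b\in R^n$ such that $a_e f_e+\sum_{k=1}^n b_k\,\partial f_e/\partial x_k=0$ for every $e\in E$. The Rees algebra of an $R$-module $M$ is the quotient of the symmetric algebra $\operatorname{Sym}_R(M)$ by its $R$-torsion. The arrangement $\mathcal{A}(G)$ is called gentle if $M(\mathcal{A}(G))$ is of linear type, that is, if the canonical map from $\operatorname{Sym}_R(M(\mathcal{A}(G)))$ to the Rees algebra of $M(\mathcal{A}(G))$ is an isomorphism. The octahedron graph is the graph with vertices $1,\dots,6$ in which two distinct vertices are adjacent unless they form one of the pairs $\{1,4\},\{2,5\},\{3,6\}$. If $G$ contains an induced subgraph isomorphic to the octahedron graph, then $\mathcal{A}(G)$ is not gentle. -/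

import Mathlib

noncomputable section

/-- The ideal of the symmetric algebra `Sym_R(M)` formed by its `R`-torsion elements, that is, by
the elements annihilated by some non-zero-divisor of `R`. -/
def symTorsionIdeal (R M : Type*) [CommRing R] [AddCommGroup M] [Module R M] :
    Ideal (SymmetricAlgebra R M) where
  carrier := (Submodule.torsion R (SymmetricAlgebra R M) : Set (SymmetricAlgebra R M))
  add_mem' := (Submodule.torsion R (SymmetricAlgebra R M)).add_mem
  zero_mem' := (Submodule.torsion R (SymmetricAlgebra R M)).zero_mem
  smul_mem' := by
    rintro c x ⟨a, ha⟩
    refine ⟨a, ?_⟩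
    rw [smul_eq_mul, ← mul_smul_comm, ha, mul_zero]

theorem mem_symTorsionIdeal {R M : Type*} [CommRing R] [AddCommGroup M] [Module R M]
    {z : SymmetricAlgebra R M} :
    z ∈ symTorsionIdeal R M ↔ ∃ r ∈ nonZeroDivisors R, r • z = 0 := by
  change z ∈ Submodule.torsion R (SymmetricAlgebra R M) ↔ _
  constructor
  · rintro ⟨a, ha⟩
    exact ⟨a.1, a.2, ha⟩
  · rintro ⟨r, hr, h⟩
    exact ⟨⟨r, hr⟩, h⟩

/-- The Rees algebra of a module `M`: the symmetric algebra modulo its `R`-torsion. -/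
abbrev ModuleReesAlgebra (R M : Type*) [CommRing R] [AddCommGroup M] [Module R M] : Type _ :=
  SymmetricAlgebra R M ⧸ symTorsionIdeal R M

/-- `M` is of linear type if the canonical map from its symmetric algebra to its Rees algebra is
an isomorphism. -/
def IsOfLinearType (R M : Type*) [CommRing R] [AddCommGroup M] [Module R M] : Prop :=
  Function.Bijective
    (Ideal.Quotient.mk (symTorsionIdeal R M) : SymmetricAlgebra R M → ModuleReesAlgebra R M)

section Arrangement

variable {ι σ : Type*} [Fintype ι] [DecidableEq ι] [Fintype σ]

/-- The matrix `Q = [diag(f_i) | ∂f_i/∂x_j]` of an arrangement `f`, with rows indexed by the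
hypersurfaces and columns by the hypersurfaces followed by the variables. -/
def arrangementMatrix (f : ι → MvPolynomial σ ℂ) : Matrix ι (ι ⊕ σ) (MvPolynomial σ ℂ) :=
  Matrix.fromCols (Matrix.diagonal f) (Matrix.of fun i j => MvPolynomial.pderiv j (f i))

/-- The log-derivation module: the image of `ker Q` under the projection to the first block of
coordinates, those indexed by the hypersurfaces. -/
def logDerModule (f : ι → MvPolynomial σ ℂ) :
    Submodule (MvPolynomial σ ℂ) (ι → MvPolynomial σ ℂ) :=
  (LinearMap.ker (arrangementMatrix f).mulVecLin).map
    (LinearMap.funLeft (MvPolynomial σ ℂ) (MvPolynomial σ ℂ) (Sum.inl : ι → ι ⊕ σ))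

/-- The likelihood module: the cokernel of the inclusion of the log-derivation module. -/
abbrev LikelihoodModule (f : ι → MvPolynomial σ ℂ) : Type _ :=
  (ι → MvPolynomial σ ℂ) ⧸ logDerModule f

/-- An arrangement is gentle if its likelihood module is of linear type. -/
def IsGentle (f : ι → MvPolynomial σ ℂ) : Prop :=
  IsOfLinearType (MvPolynomial σ ℂ) (LikelihoodModule f)

end Arrangement

/-- The graphic arrangement of a graph on the vertices `0, …, n - 1`: the linear forms
`x_i - x_j`, one for every edge `{i, j}` with `i < j`. -/
def graphicArrangement {n : ℕ} (G : SimpleGraph (Fin n)) :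
    G.edgeSet → MvPolynomial (Fin n) ℂ :=
  fun e => MvPolynomial.X (Sym2.inf e.1) - MvPolynomial.X (Sym2.sup e.1)

/-- The edge graph of the octahedron: six vertices, any two distinct ones adjacent unless they
are antipodal, the antipodal pairs being `{0, 3}`, `{1, 4}` and `{2, 5}`. -/
def octahedronGraph : SimpleGraph (Fin 6) where
  Adj i j := i ≠ j ∧ i ≠ j + 3
  symm := ⟨by decide⟩
  loopless := ⟨by decide⟩

end

/-- A cubic form in the `x`-variables `d`, `w` and in the `s`-variables `p`, `q`, `r`; its
antisymmetrization over the three antipodal pairs is a torsion element of the symmetric algebra. -/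
def octahedronSeed {A : Type*} [CommRing A]
    (d1 d2 d3 w1 w2 w3 p1 p2 p3 q12 q13 q21 q23 q31 q32 r12 r13 r23 : A) : A :=
    -2 * d1 * d2 * d3 * q12 * q21 * q31 - d1 * d2 * d3 * q12 * q23 * q31 +
    2 * d1 * d2 * w1 * p1 * q23 * q31 + 2 * d1 * d2 * w1 * q12 * q32 * r12 +
    2 * d1 * d2 * w1 * q13 * q32 * r12 + 2 * d1 * w1 * w2 * p1 * q13 * r13 +
    2 * d1 * w1 * w2 * p3 * q12 * r13 - 2 * d1 * w1 * w2 * q21 * q23 * q31 -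
    2 * d1 * w1 * w2 * q23 * r12 * r13 - 2 * d1 * w1 * w2 * q23 ^ 2 * q31 +
    2 * d1 * w1 ^ 2 * p1 * q23 * r13 - d1 * w1 ^ 2 * q12 * q23 * q31 +
    2 * d1 * w1 ^ 2 * q12 * q23 * q32 + 2 * d1 * w2 * w3 * p2 * p3 * q12 -
    2 * d1 * w2 * w3 * p2 * q23 * r12 + 2 * d1 * w2 ^ 2 * p3 * q21 * r13 +
    d1 ^ 2 * w1 * p2 * q21 * q32 + d1 ^ 2 * w1 * q12 * q21 * r13 +
    d1 ^ 2 * w2 * p2 * q12 * q32 + 2 * d1 ^ 2 * w2 * p2 * q13 * q31 +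
    d1 ^ 2 * w2 * q21 ^ 2 * r13 + w1 ^ 2 * w2 * p1 * q12 * q31 + w1 ^ 2 * w2 * p1 ^ 2 * r13 -
    w1 ^ 2 * w2 * p2 * q12 * q32 + 2 * w1 ^ 2 * w2 * p2 * r12 * r23 +
    w1 ^ 2 * w2 * p3 * q13 * q32 - w1 ^ 2 * w2 * q12 * q21 * r23 +
    w1 ^ 2 * w2 * q12 ^ 2 * r13 - w1 ^ 2 * w2 * q13 ^ 2 * r13 -
    w1 ^ 2 * w2 * q23 * q32 * r12 + w1 ^ 2 * w2 * q23 ^ 2 * r13 - w1 ^ 3 * p1 * p2 * r23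

/-- The antisymmetrization of `octahedronSeed`. -/
def octahedronCubic {A : Type*} [CommRing A]
    (d1 d2 d3 w1 w2 w3 p1 p2 p3 q12 q13 q21 q23 q31 q32 r12 r13 r23 : A) : A :=
  octahedronSeed d1 d2 d3 w1 w2 w3 p1 p2 p3 q12 q13 q21 q23 q31 q32 r12 r13 r23 +
    octahedronSeed d2 d3 d1 w2 w3 w1 p2 p3 p1 q23 q21 q32 q31 q12 q13 r23 r12 r13 +
    octahedronSeed d3 d1 d2 w3 w1 w2 p3 p1 p2 q31 q32 q13 q12 q23 q21 r13 r23 r12 -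
    octahedronSeed (-d2) (-d1) (-d3) w2 w1 w3 p2 p1 p3 q21 q23 q12 q13 q32 q31 r12 r23 r13 -
    octahedronSeed (-d1) (-d3) (-d2) w1 w3 w2 p1 p3 p2 q13 q12 q31 q32 q21 q23 r13 r12 r23 -
    octahedronSeed (-d3) (-d2) (-d1) w3 w2 w1 p3 p2 p1 q32 q31 q23 q21 q13 q12 r23 r13 r12

/-- The antisymmetrized cubic is killed by a linear form, modulo the relations of the symmetric
algebra. -/
theorem mul_octahedronCubic {A : Type*} [CommRing A]
    {d1 d2 d3 w1 w2 w3 p1 p2 p3 q12 q13 q21 q23 q31 q32 r12 r13 r23 : A}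
    (hd : d1 + d2 + d3 = 0) (hp : p1 + p2 + p3 = 0)
    (h2 : d2 * p1 - d1 * p2 + w1 * (q12 + q13) + w2 * (q21 + q23) + w3 * (q31 + q32) = 0)
    (h3 : -(w1 ^ 2 * p1) - w2 ^ 2 * p2 - w3 ^ 2 * p3 + w1 * (d3 * q13 - d2 * q12) +
      w2 * (d1 * q21 - d3 * q23) + w3 * (d2 * q32 - d1 * q31) +
      w1 * w2 * r12 + w1 * w3 * r13 + w2 * w3 * r23 = 0)
    (h1a : ((d3 + w1) * (p3 + q12) + w2 * (q21 + r12)) * ((-d2 + w1) ^ 2 - w3 ^ 2) +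
      ((-d2 + w1) * (p2 + q13) + w3 * (q31 + r13)) * ((d3 + w1) ^ 2 - w2 ^ 2) = 0)
    (h1b : ((d3 - w1) * (p3 - q12) + w2 * (q21 - r12)) * ((-d2 - w1) ^ 2 - w3 ^ 2) +
      ((-d2 - w1) * (p2 - q13) + w3 * (q31 - r13)) * ((d3 - w1) ^ 2 - w2 ^ 2) = 0)
    (h2a : ((-d3 + w2) * (p3 + q21) + w1 * (q12 + r12)) * ((d1 + w2) ^ 2 - w3 ^ 2) +
      ((d1 + w2) * (p1 + q23) + w3 * (q32 + r23)) * ((-d3 + w2) ^ 2 - w1 ^ 2) = 0)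
    (h2b : ((-d3 - w2) * (p3 - q21) + w1 * (q12 - r12)) * ((d1 - w2) ^ 2 - w3 ^ 2) +
      ((d1 - w2) * (p1 - q23) + w3 * (q32 - r23)) * ((-d3 - w2) ^ 2 - w1 ^ 2) = 0)
    (h3a : ((d2 + w3) * (p2 + q31) + w1 * (q13 + r13)) * ((-d1 + w3) ^ 2 - w2 ^ 2) +
      ((-d1 + w3) * (p1 + q32) + w2 * (q23 + r23)) * ((d2 + w3) ^ 2 - w1 ^ 2) = 0)
    (h3b : ((d2 - w3) * (p2 - q31) + w1 * (q13 - r13)) * ((-d1 - w3) ^ 2 - w2 ^ 2) +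
      ((-d1 - w3) * (p1 - q32) + w2 * (q23 - r23)) * ((d2 - w3) ^ 2 - w1 ^ 2) = 0)
    : 2 * (w1 * octahedronCubic d1 d2 d3 w1 w2 w3 p1 p2 p3 q12 q13 q21 q23 q31 q32 r12 r13 r23) =
      0 := by
  obtain rfl : d3 = -d1 - d2 := by linear_combination hd
  obtain rfl : p3 = -p1 - p2 := by linear_combination hp
  simp only [octahedronCubic, octahedronSeed]
  -- An explicit ideal membership. The relations at two antipodal vertices enter through their sum
  -- and difference, their even and odd parts under swapping that pair.
  linear_combination
    2 * (q12 * r13 * w1 ^ 2 * w2 - q21 * r23 * w1 ^ 2 * w2 - 2 * (-p1 - p2) * d1 ^ 2 * q23 * w3 -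
    d2 * p1 * r12 * w1 * w3 + d2 * p1 * r13 * w1 * w2 - 2 * d1 * q23 * q31 * w1 ^ 2 +
    q23 * r23 * w1 ^ 2 * w2 + 2 * (-p1 - p2) * d1 * d2 * q21 * w3 -
    3 * d2 * p1 * r23 * w1 ^ 2 + 2 * d1 ^ 2 * d2 * q21 * q32 + 2 * d1 * q31 ^ 2 * w2 * w3 -
    q32 * r23 * w1 ^ 2 * w3 + 2 * d1 * d2 * q32 * r12 * w1 - 2 * d1 * d2 * q13 * r23 * w1 -
    2 * d2 ^ 2 * q13 * r23 * w1 - q32 * r13 * w1 * w2 * w3 + q12 * r23 * w1 * w3 ^ 2 -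
    2 * d1 * d2 * p2 * q32 * w2 + 2 * d2 * q13 * q21 * w1 * w3 - q13 * r23 * w1 ^ 3 -
    3 * d1 * p2 * r13 * w1 * w2 - 3 * (-p1 - p2) * d1 * r23 * w3 ^ 2 +
    q23 * r13 * w1 * w3 ^ 2 + d1 ^ 2 * q23 * r13 * w1 + 2 * d2 * r13 * r23 * w1 * w3 -
    2 * (-p1 - p2) * d1 ^ 2 * q21 * w3 + 2 * d1 * q13 * q31 * w1 * w2 -
    q31 * r13 * w1 * w2 * w3 + q12 * r12 * w1 ^ 2 * w3 + q23 * r12 * w1 * w2 * w3 +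
    2 * d2 * q13 * q31 * w1 * w2 + d1 ^ 2 * q21 * r13 * w1 - q13 * r13 * w1 ^ 2 * w2 -
    2 * d1 * d2 * p2 * q31 * w2 - d1 * p2 * r12 * w1 * w3 - q31 * r23 * w1 ^ 2 * w3 -
    d2 ^ 2 * q12 * r23 * w1 - 2 * (-p1 - p2) * d1 * r13 * w1 * w2 +
    4 * (-p1 - p2) * d1 * p2 * w2 * w3 - 2 * (-p1 - p2) * d1 * r12 * w1 * w3 +
    2 * d1 * q31 * q32 * w2 * w3 - d1 * q21 * q31 * w1 ^ 2 - d1 * d2 ^ 2 * q21 * q31 -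
    q13 * r12 * w1 ^ 2 * w3 + 2 * d1 * q12 * q23 * w1 * w3 - q31 * r12 * w1 * w3 ^ 2 -
    2 * (-p1 - p2) * d1 * d2 * q23 * w3 - d1 * p1 * r23 * w1 ^ 2 +
    2 * d1 * r13 * r23 * w1 * w3 - q32 * r12 * w1 * w3 ^ 2 - q21 * r13 * w1 * w3 ^ 2 +
    (-p1 - p2) * d1 * d2 ^ 2 * r23 - 2 * d1 * q21 * q32 * w3 ^ 2 - d1 * q21 * q31 * w3 ^ 2 -
    q21 * r12 * w1 * w2 * w3 + 2 * d1 * q13 * q32 * w1 * w2) * h2 +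
    2 * (4 * (-p1 - p2) * d1 * q21 * w3 + 2 * (-d1 - d2) * (-p1 - p2) * q21 * w3 +
    2 * q13 * q21 * w1 * w3 - 2 * d1 * d2 * q21 * q32 - 4 * (-p1 - p2) * d2 * q31 * w2 +
    2 * (-p1 - p2) * r23 * w3 ^ 2 - 2 * d2 * p2 * q32 * w2 - 2 * (-p1 - p2) * r23 * w1 ^ 2 +
    2 * q13 * q31 * w1 * w2 + 2 * q21 * q31 * w3 ^ 2 -
    2 * (-d1 - d2) * (-p1 - p2) * q23 * w3 + 2 * q31 * q32 * w2 * w3 +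
    2 * q21 * q32 * w3 ^ 2 + 2 * q31 ^ 2 * w2 * w3 - 2 * q12 * q23 * w1 * w3 -
    2 * d2 * p2 * q31 * w2 - 2 * d1 * q23 * r13 * w1 + 2 * q13 * q32 * w1 * w2) * h3 +
    (q32 * r23 * w3 + p1 * q31 * w2 + q31 * r23 * w3 + (-p1 - p2) * q23 * w3 + q13 * r23 * w1 -
    p2 * q32 * w2 + d1 * q21 * q31 + d1 * q23 * q31 + d1 * q23 * q32) * (h1a + h1b) +
    (-p1 * r23 * w1) * (h1a - h1b) +
    (-(-p1 - p2) * p2 * w3 - q13 * q32 * w1 + d2 * p2 * q32 - d2 * p1 * q31 - q31 ^ 2 * w3 -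
    q31 * q32 * w3 - q13 * q31 * w1 - p1 * r13 * w1) * (h2a - h2b) +
    ((-p1 - p2) * q31 * w2 + q32 * r12 * w1 - q23 * r13 * w1 + (-p1 - p2) * d2 * r23 +
    d1 * q21 * q32 + (-p1 - p2) * q21 * w3) * (h3a + h3b) +
    (p1 * r12 * w1 + (-p1 - p2) * p2 * w2 + q12 * q23 * w1 - q21 * q32 * w3 - q13 * q21 * w1 +
    (-d1 - d2) * (-p1 - p2) * q23 - (-p1 - p2) * d1 * q21 - 2 * (-p1 - p2) * r23 * w3 -
    q21 * q31 * w3) * (h3a - h3b)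

/-! ### Divisibility by differences of variables. -/

namespace MvPolynomial

variable {σ K : Type*} [Field K]

open Classical in
/-- The substitution replacing the variable `i` by the variable `j`. -/
noncomputable def substVar (i j : σ) : MvPolynomial σ K →ₐ[K] MvPolynomial σ K :=
  aeval fun k => X (if k = i then j else k)

open Classical in
@[simp]
theorem substVar_X (i j k : σ) :
    substVar i j (X k : MvPolynomial σ K) = X (if k = i then j else k) := by
  simp [substVar]

theorem X_sub_X_dvd_sub_substVar (i j : σ) (F : MvPolynomial σ K) :
    X i - X j ∣ F - substVar i j F := by
  induction F using MvPolynomial.induction_on with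
  | C a => simp [substVar]
  | add p q hp hq =>
    rw [map_add, add_sub_add_comm]
    exact dvd_add hp hq
  | mul_X p k hp =>
    have h : (X i - X j : MvPolynomial σ K) ∣ X k - substVar i j (X k) := by
      by_cases hk : k = i <;> simp [hk]
    rw [map_mul]
    have : p * X k - substVar i j p * substVar i j (X k) =
      (p - substVar i j p) * X k + substVar i j p * (X k - substVar i j (X k)) := by ring
    rw [this]
    exact dvd_add (hp.mul_right _) (h.mul_left _)

theorem X_sub_X_dvd_iff (i j : σ) (F : MvPolynomial σ K) :
    X i - X j ∣ F ↔ substVar i j F = 0 := by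
  constructor
  · rintro ⟨k, rfl⟩
    by_cases h : j = i <;> simp [h]
  · intro h
    simpa [h] using X_sub_X_dvd_sub_substVar i j F

/-- Modulo `X i - X j` one is again in a polynomial domain, and `hne` lists the ways in which `X k -
X l` stays nonzero there. -/
theorem X_sub_X_dvd_of_dvd_mul {i j k l : σ} {F : MvPolynomial σ K}
    (h : X i - X j ∣ (X k - X l) * F)
    (hne : (k ≠ i ∧ l ≠ i ∧ k ≠ l) ∨ (k = i ∧ l ≠ i ∧ l ≠ j) ∨ (l = i ∧ k ≠ i ∧ k ≠ j)) :
    X i - X j ∣ F := by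
  rw [X_sub_X_dvd_iff, map_mul] at h
  rw [X_sub_X_dvd_iff]
  refine (mul_eq_zero.mp h).resolve_left ?_
  rw [map_sub, substVar_X, substVar_X, sub_eq_zero, (X_injective).eq_iff]
  rcases hne with ⟨h1, h2, h3⟩ | ⟨h1, h2, h3⟩ | ⟨h1, h2, h3⟩
  · simp [h1, h2, h3]
  · simp [h1, h2, Ne.symm h3]
  · simp [h1, h2, h3]

theorem X_sub_X_mul_dvd {i j k : σ} {F : MvPolynomial σ K} (hij : j ≠ i)
    (hjk : j ≠ k) (hj : X i - X j ∣ F) (hk : X i - X k ∣ F) :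
    (X i - X j) * (X i - X k) ∣ F := by
  obtain ⟨G, rfl⟩ := hj
  exact mul_dvd_mul_left _ (X_sub_X_dvd_of_dvd_mul hk (.inr (.inl ⟨rfl, hij, hjk⟩)))

/-- A polynomial whose restriction to `x_i = x_k` is divisible by two linear forms. -/
theorem exists_eq_add_of_dvd_substVar {i j k l : σ} {F : MvPolynomial σ K} (hij : j ≠ i)
    (hjl : j ≠ l)
    (hj : X i - X j ∣ substVar k i F) (hl : X i - X l ∣ substVar k i F) :
    ∃ g d, F = (X i - X k) * g + (X i - X j) * (X i - X l) * d := by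
  obtain ⟨d, hd⟩ := X_sub_X_mul_dvd hij hjl hj hl
  obtain ⟨g, hg⟩ := X_sub_X_dvd_sub_substVar k i F
  exact ⟨-g, d, by linear_combination hg + hd⟩

end MvPolynomial

/-! ### Generators for the splines on the octahedron. -/

open MvPolynomial in
/-- Splines on the octahedron: a tuple of polynomials whose differences along the edges are
divisible by the corresponding linear forms is a combination of Newton polynomials and of tuples
supported at a single vertex. -/
theorem exists_octahedron_spline_expansion {K : Type*} [Field K]
    {b : Fin 6 → MvPolynomial (Fin 6) K}
    (hb : ∀ i j, octahedronGraph.Adj i j → X i - X j ∣ b i - b j) :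
    ∃ c₀ c₁ c₂ c₃ c₄ c₅ : MvPolynomial (Fin 6) K, ∃ d : Fin 6 → MvPolynomial (Fin 6) K,
      ∀ i, b i = c₀ + c₁ * (X i - X 0) + c₂ * ((X i - X 0) * (X i - X 1)) +
        (X i - X 0) * (X i - X 1) * (X i - X 2) *
          (c₃ + c₄ * (X i - X 3) + c₅ * ((X i - X 3) * (X i - X 4))) +
        d i * ((X i - X (i + 1)) * (X i - X (i + 2)) * (X i - X (i + 4)) * (X i - X (i + 5))) := by
  have adj : ∀ i j, octahedronGraph.Adj i j ↔ (i ≠ j ∧ i ≠ j + 3) := fun i j => Iff.rfl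
  simp only [adj] at hb
  obtain ⟨c₁, h₁⟩ := hb 1 0 (by decide)
  have h20 : X 2 - X 0 ∣ b 2 - b 0 - c₁ * (X 2 - X 0) :=
    dvd_sub (hb 2 0 (by decide)) (Dvd.intro_left _ rfl)
  have h21 : X 2 - X 1 ∣ b 2 - b 0 - c₁ * (X 2 - X 0) := by
    have : b 2 - b 0 - c₁ * (X 2 - X 0) = (b 2 - b 1) - c₁ * (X 2 - X 1) := by
      linear_combination h₁
    rw [this]
    exact dvd_sub (hb 2 1 (by decide)) (Dvd.intro_left _ rfl)
  obtain ⟨c₂, h₂⟩ := X_sub_X_mul_dvd (by decide) (by decide) h20 h21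
  -- Newton interpolation on the triangle 0, 1, 2 leaves a spline vanishing at these three vertices.
  set b' : Fin 6 → MvPolynomial (Fin 6) K := fun i =>
    b i - b 0 - c₁ * (X i - X 0) - c₂ * ((X i - X 0) * (X i - X 1)) with hb'
  have b'0 : b' 0 = 0 := by simp [hb']
  have b'1 : b' 1 = 0 := by simp only [hb']; linear_combination h₁
  have b'2 : b' 2 = 0 := by simp only [hb']; linear_combination h₂
  have hs : ∀ i j, (i ≠ j ∧ i ≠ j + 3) → X i - X j ∣ b' i - b' j := by
    intro i j hij
    have : b' i - b' j = (b i - b j) - (X i - X j) * (c₁ + c₂ * (X i + X j - X 0 - X 1)) := by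
      simp only [hb']; ring
    rw [this]
    exact dvd_sub (hb i j hij) (Dvd.intro _ rfl)
  have key : ∀ i j k, j ≠ i → j ≠ k → (i ≠ j ∧ i ≠ j + 3) → (i ≠ k ∧ i ≠ k + 3) →
      b' j = 0 → b' k = 0 → (X i - X j) * (X i - X k) ∣ b' i := by
    intro i j k h1 h3 h4 h5 h6 h7
    exact X_sub_X_mul_dvd h1 h3 (by simpa [h6] using hs i j h4) (by simpa [h7] using hs i k h5)
  obtain ⟨e3, he3⟩ := key 3 1 2 (by decide) (by decide) (by decide) (by decide) b'1 b'2
  obtain ⟨e4, he4⟩ := key 4 0 2 (by decide) (by decide) (by decide) (by decide) b'0 b'2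
  obtain ⟨e5, he5⟩ := key 5 0 1 (by decide) (by decide) (by decide) (by decide) b'0 b'1
  -- On `x₃ = x₄` the values at 3 and 4 share the factor `x₄ - x₂`, which cancels. The other two
  -- edges of the triangle 3, 4, 5 behave alike.
  have h34 : X 3 - X 4 ∣ (X 4 - X 1) * e3 - (X 4 - X 0) * e4 := by
    refine X_sub_X_dvd_of_dvd_mul (k := 4) (l := 2) ?_ (by decide)
    obtain ⟨m, hm⟩ := hs 3 4 (by decide)
    exact ⟨m - (X 3 + X 4 - X 1 - X 2) * e3, by linear_combination hm - he3 + he4⟩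
  have h35 : X 3 - X 5 ∣ (X 5 - X 2) * e3 - (X 5 - X 0) * e5 := by
    refine X_sub_X_dvd_of_dvd_mul (k := 5) (l := 1) ?_ (by decide)
    obtain ⟨m, hm⟩ := hs 3 5 (by decide)
    exact ⟨m - (X 3 + X 5 - X 1 - X 2) * e3, by linear_combination hm - he3 + he5⟩
  have h45 : X 4 - X 5 ∣ (X 5 - X 2) * e4 - (X 5 - X 1) * e5 := by
    refine X_sub_X_dvd_of_dvd_mul (k := 5) (l := 0) ?_ (by decide)
    obtain ⟨m, hm⟩ := hs 4 5 (by decide)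
    exact ⟨m - (X 4 + X 5 - X 0 - X 2) * e4, by linear_combination hm - he4 + he5⟩
  obtain ⟨m34, hm34⟩ := h34
  obtain ⟨m35, hm35⟩ := h35
  obtain ⟨m45, hm45⟩ := h45
  -- On `x₀ = x₃` the `e4` term of `hm34` acquires the factor `x₄ - x₃`, and the `e5` term of `hm35`
  -- the factor `x₅ - x₃`. So the restriction of `e3` is divisible by both forms, and `d3` becomes
  -- the coefficient of the spline supported at 3.
  obtain ⟨g3, d3, h3⟩ : ∃ g d, e3 = (X 3 - X 0) * g + (X 3 - X 4) * (X 3 - X 5) * d := by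
    refine exists_eq_add_of_dvd_substVar (by decide) (by decide) ?_ ?_
    · have := congrArg (substVar 0 3) hm34
      simp [map_mul, map_sub] at this
      refine X_sub_X_dvd_of_dvd_mul (k := 4) (l := 1)
        ⟨substVar 0 3 m34 - substVar 0 3 e4, ?_⟩ (by decide)
      linear_combination this
    · have := congrArg (substVar 0 3) hm35
      simp [map_mul, map_sub] at this
      refine X_sub_X_dvd_of_dvd_mul (k := 5) (l := 2)
        ⟨substVar 0 3 m35 - substVar 0 3 e5, ?_⟩ (by decide)
      linear_combination this
  obtain ⟨g4, d4, h4⟩ : ∃ g d, e4 = (X 4 - X 1) * g + (X 4 - X 3) * (X 4 - X 5) * d := by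
    refine exists_eq_add_of_dvd_substVar (by decide) (by decide) ?_ ?_
    · have := congrArg (substVar 1 4) hm34
      simp [map_mul, map_sub] at this
      refine X_sub_X_dvd_of_dvd_mul (k := 4) (l := 0)
        ⟨substVar 1 4 m34, ?_⟩ (by decide)
      linear_combination -this
    · have := congrArg (substVar 1 4) hm45
      simp [map_mul, map_sub] at this
      refine X_sub_X_dvd_of_dvd_mul (k := 5) (l := 2)
        ⟨substVar 1 4 m45 - substVar 1 4 e5, ?_⟩ (by decide)
      linear_combination this
  obtain ⟨g5, d5, h5⟩ : ∃ g d, e5 = (X 5 - X 2) * g + (X 5 - X 3) * (X 5 - X 4) * d := by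
    refine exists_eq_add_of_dvd_substVar (by decide) (by decide) ?_ ?_
    · have := congrArg (substVar 2 5) hm35
      simp [map_mul, map_sub] at this
      refine X_sub_X_dvd_of_dvd_mul (k := 5) (l := 0)
        ⟨substVar 2 5 m35, ?_⟩ (by decide)
      linear_combination -this
    · have := congrArg (substVar 2 5) hm45
      simp [map_mul, map_sub] at this
      refine X_sub_X_dvd_of_dvd_mul (k := 5) (l := 1)
        ⟨substVar 2 5 m45, ?_⟩ (by decide)
      linear_combination -this
  -- Without the one-vertex parts, `g3`, `g4`, `g5` form a spline on the triangle 3, 4, 5, which is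
  -- interpolated as before.
  have k34 : X 4 - X 3 ∣ g4 - g3 := by
    refine X_sub_X_dvd_of_dvd_mul (k := 4) (l := 1) ?_ (by decide)
    refine X_sub_X_dvd_of_dvd_mul (k := 4) (l := 0) ?_ (by decide)
    subst h3 h4
    exact ⟨m34 - (X 4 - X 1) * g3 - (X 4 - X 1) * (X 3 - X 5) * d3 -
      (X 4 - X 0) * (X 4 - X 5) * d4, by linear_combination -hm34⟩
  have k35 : X 5 - X 3 ∣ g5 - g3 := by
    refine X_sub_X_dvd_of_dvd_mul (k := 5) (l := 2) ?_ (by decide)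
    refine X_sub_X_dvd_of_dvd_mul (k := 5) (l := 0) ?_ (by decide)
    subst h3 h5
    exact ⟨m35 - (X 5 - X 2) * g3 - (X 5 - X 2) * (X 3 - X 4) * d3 -
      (X 5 - X 0) * (X 5 - X 4) * d5, by linear_combination -hm35⟩
  have k45 : X 5 - X 4 ∣ g5 - g4 := by
    refine X_sub_X_dvd_of_dvd_mul (k := 5) (l := 2) ?_ (by decide)
    refine X_sub_X_dvd_of_dvd_mul (k := 5) (l := 1) ?_ (by decide)
    subst h4 h5
    exact ⟨m45 - (X 5 - X 2) * g4 - (X 5 - X 2) * (X 4 - X 3) * d4 -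
      (X 5 - X 1) * (X 5 - X 3) * d5, by linear_combination -hm45⟩
  obtain ⟨c₄, hc₄⟩ := k34
  have k53 : X 5 - X 3 ∣ g5 - g3 - c₄ * (X 5 - X 3) := dvd_sub k35 (Dvd.intro_left _ rfl)
  have k54 : X 5 - X 4 ∣ g5 - g3 - c₄ * (X 5 - X 3) := by
    have : g5 - g3 - c₄ * (X 5 - X 3) = (g5 - g4) - c₄ * (X 5 - X 4) := by
      linear_combination hc₄
    rw [this]
    exact dvd_sub k45 (Dvd.intro_left _ rfl)
  obtain ⟨c₅, hc₅⟩ := X_sub_X_mul_dvd (by decide) (by decide) k53 k54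
  have hbb : ∀ i, b i = b 0 + c₁ * (X i - X 0) + c₂ * ((X i - X 0) * (X i - X 1)) + b' i := by
    intro i; simp only [hb']; ring
  refine ⟨b 0, c₁, c₂, g3, c₄, c₅, ![0, 0, 0, d3, d4, d5], fun i => ?_⟩
  rw [hbb i, add_assoc (_ + _ + _) (_ * (_ + _ + _)), add_right_inj]
  fin_cases i
  · simp [b'0]
  · simp [b'1]
  · simp [b'2]
  · have e1 : (3 : Fin 6) + 1 = 4 := rfl
    have e2 : (3 : Fin 6) + 2 = 5 := rfl
    have e3 : (3 : Fin 6) + 4 = 1 := rfl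
    have e4 : (3 : Fin 6) + 5 = 2 := rfl
    simp [e1, e2, e3, e4, he3, h3]
    ring
  · have e1 : (4 : Fin 6) + 1 = 5 := rfl
    have e2 : (4 : Fin 6) + 2 = 0 := rfl
    have e3 : (4 : Fin 6) + 4 = 2 := rfl
    have e4 : (4 : Fin 6) + 5 = 3 := rfl
    simp [e1, e2, e3, e4, he4, h4]
    linear_combination ((X 4 - X 0) * (X 4 - X 1) * (X 4 - X 2)) * hc₄
  · have e1 : (5 : Fin 6) + 1 = 0 := rfl
    have e2 : (5 : Fin 6) + 2 = 1 := rfl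
    have e3 : (5 : Fin 6) + 4 = 3 := rfl
    have e4 : (5 : Fin 6) + 5 = 4 := rfl
    simp [e1, e2, e3, e4, he5, h5]
    linear_combination ((X 5 - X 0) * (X 5 - X 1) * (X 5 - X 2)) * hc₅

/-! ### Edge variables and the test point. -/

/-- The sum of `t i j` over the edges `i < j` of the octahedron. -/
def octahedronSum {A : Type*} [AddCommMonoid A] (t : Fin 6 → Fin 6 → A) : A :=
  t 0 1 + t 0 2 + t 0 4 + t 0 5 + t 1 2 + t 1 3 + t 1 5 + t 2 3 + t 2 4 + t 3 4 + t 3 5 + t 4 5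

/-- The cubic `octahedronCubic` expressed in vertex variables `x` and edge variables `s`. -/
def octahedronForm {A : Type*} [CommRing A] (x : Fin 6 → A) (s : Fin 6 → Fin 6 → A) : A :=
  octahedronCubic (x 1 + x 4 - x 2 - x 5) (x 2 + x 5 - x 0 - x 3) (x 0 + x 3 - x 1 - x 4)
    (x 0 - x 3) (x 1 - x 4) (x 2 - x 5)
    (s 1 2 + s 1 5 + s 2 4 + s 4 5) (s 0 2 + s 0 5 + s 2 3 + s 3 5) (s 0 1 + s 0 4 + s 1 3 + s 3 4)
    (s 0 1 + s 0 4 - s 1 3 - s 3 4) (s 0 2 + s 0 5 - s 2 3 - s 3 5)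
    (s 0 1 - s 0 4 + s 1 3 - s 3 4) (s 1 2 + s 1 5 - s 2 4 - s 4 5)
    (s 0 2 - s 0 5 + s 2 3 - s 3 5) (s 1 2 - s 1 5 + s 2 4 - s 4 5)
    (s 0 1 - s 0 4 - s 1 3 + s 3 4) (s 0 2 - s 0 5 - s 2 3 + s 3 5)
    (s 1 2 - s 1 5 - s 2 4 + s 4 5)

/-- Needed because each octahedral edge variable of a larger graph appears multiplied by the outer
product. -/
theorem octahedronForm_mul {A : Type*} [CommRing A] (x : Fin 6 → A) (s : Fin 6 → Fin 6 → A)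
    (c : A) : octahedronForm x (fun i j => c * s i j) = c ^ 3 * octahedronForm x s := by
  have h : ∀ d1 d2 d3 w1 w2 w3 p1 p2 p3 q12 q13 q21 q23 q31 q32 r12 r13 r23 : A,
      octahedronCubic d1 d2 d3 w1 w2 w3 (c * p1) (c * p2) (c * p3) (c * q12) (c * q13) (c * q21)
        (c * q23) (c * q31) (c * q32) (c * r12) (c * r13) (c * r23) =
      c ^ 3 * octahedronCubic d1 d2 d3 w1 w2 w3 p1 p2 p3 q12 q13 q21 q23 q31 q32 r12 r13 r23 := by
    intros
    have hs : ∀ d1 d2 d3 w1 w2 w3 p1 p2 p3 q12 q13 q21 q23 q31 q32 r12 r13 r23 : A,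
        octahedronSeed d1 d2 d3 w1 w2 w3 (c * p1) (c * p2) (c * p3) (c * q12) (c * q13) (c * q21)
          (c * q23) (c * q31) (c * q32) (c * r12) (c * r13) (c * r23) =
        c ^ 3 * octahedronSeed d1 d2 d3 w1 w2 w3 p1 p2 p3 q12 q13 q21 q23 q31 q32 r12 r13 r23 := by
      intros
      simp only [octahedronSeed]
      ring
    simp only [octahedronCubic, hs]
    ring
  simp only [octahedronForm, ← mul_add, ← mul_sub, h]

theorem map_octahedronForm {A B : Type*} [CommRing A] [CommRing B] (φ : A →+* B)
    (x : Fin 6 → A) (s : Fin 6 → Fin 6 → A) :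
    φ (octahedronForm x s) = octahedronForm (fun i => φ (x i)) (fun i j => φ (s i j)) := by
  simp only [octahedronForm, octahedronCubic, octahedronSeed, map_add, map_sub, map_mul, map_pow,
    map_neg, map_ofNat]

/-- The coordinates of the test point. -/
def testPoint {B : Type*} [CommRing B] (α β γ : B) : Fin 6 → B :=
  ![α - β, α + β, γ, β - α, -α - β, -γ]

/-- The edge weights of the test point. -/
def testWeight {B : Type*} [CommRing B] (i j : Fin 6) : B :=
  if i = 2 ∨ i = 5 ∨ j = 2 ∨ j = 5 then 1 else if i < 3 ↔ j < 3 then -1 else -3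

theorem testWeight_values {B : Type*} [CommRing B] :
    testWeight 0 1 = (-1 : B) ∧ testWeight 0 2 = (1 : B) ∧ testWeight 0 4 = (-3 : B) ∧
    testWeight 0 5 = (1 : B) ∧ testWeight 1 2 = (1 : B) ∧ testWeight 1 3 = (-3 : B) ∧
    testWeight 1 5 = (1 : B) ∧ testWeight 2 3 = (1 : B) ∧ testWeight 2 4 = (1 : B) ∧
    testWeight 3 4 = (-1 : B) ∧ testWeight 3 5 = (1 : B) ∧ testWeight 4 5 = (1 : B) := by
  refine ⟨?_, ?_, ?_, ?_, ?_, ?_, ?_, ?_, ?_, ?_, ?_, ?_⟩ <;> simp [testWeight]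

theorem octahedronForm_testPoint {B : Type*} [CommRing B] (α β γ : B) :
    octahedronForm (testPoint α β γ) testWeight = 2048 * (α * β * γ) := by
  obtain ⟨h1, h2, h3, h4, h5, h6, h7, h8, h9, h10, h11, h12⟩ := testWeight_values (B := B)
  -- Point and weights are invariant under the antipode, up to a sign on the point, so all `d` and
  -- `q` vanish.
  have key : octahedronCubic 0 0 0 (2 * (α - β)) (2 * (α + β)) (2 * γ) 4 4 (-8) 0 0 0 0 0 0 4 0 0 =
      2048 * (α * β * γ) := by
    simp only [octahedronCubic, octahedronSeed]
    ring
  rw [← key, octahedronForm]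
  simp only [h1, h2, h3, h4, h5, h6, h7, h8, h9, h10, h11, h12, testPoint, Matrix.cons_val]
  congr 1 <;> ring

/-! ### Divided differences and the relations at the test point. -/

section DividedDifferences

variable {B : Type*} [CommRing B] (x : Fin 6 → B) (i j : Fin 6)

/-- The divided difference of `(t - x₀)(t - x₁)(t - x₂)`. -/
def newtonDiff₃ : B := (x i - x 0) * (x i - x 1) + (x j - x 2) * (x i + x j - x 0 - x 1)

/-- The divided difference of `(t - x₀)(t - x₁)(t - x₂)(t - x₃)`. -/
def newtonDiff₄ : B :=
  (x i - x 0) * (x i - x 1) * (x i - x 2) + (x j - x 3) * newtonDiff₃ x i j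

/-- The divided difference of `(t - x₀)(t - x₁)(t - x₂)(t - x₃)(t - x₄)`. -/
def newtonDiff₅ : B :=
  (x i - x 0) * (x i - x 1) * (x i - x 2) * (x i - x 3) + (x j - x 4) * newtonDiff₄ x i j

/-- The product of `x i - x k` over the neighbours `k ≠ j` of `i` in the octahedron. -/
def starDiff : B := (x i - x (j + 3)) * (x i - x (-(i + j))) * (x i - x (3 - (i + j)))

end DividedDifferences

/-- The three antipodal pairs are the classes mod 3, with sum 0. Hence the pair containing neither
`i` nor `j` is `-(i + j)`, `3 - (i + j)`. -/
theorem mul_starDiff {B : Type*} [CommRing B] (x : Fin 6 → B) {i j : Fin 6}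
    (h : octahedronGraph.Adj i j) :
    (x i - x j) * starDiff x i j =
      (x i - x (i + 1)) * (x i - x (i + 2)) * (x i - x (i + 4)) * (x i - x (i + 5)) := by
  replace h : i ≠ j ∧ i ≠ j + 3 := h
  have : j = i + 1 ∧ j + 3 = i + 4 ∧ (-(i + j) = i + 2 ∧ 3 - (i + j) = i + 5 ∨
      -(i + j) = i + 5 ∧ 3 - (i + j) = i + 2) ∨
    j = i + 2 ∧ j + 3 = i + 5 ∧ (-(i + j) = i + 1 ∧ 3 - (i + j) = i + 4 ∨
      -(i + j) = i + 4 ∧ 3 - (i + j) = i + 1) ∨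
    j = i + 4 ∧ j + 3 = i + 1 ∧ (-(i + j) = i + 2 ∧ 3 - (i + j) = i + 5 ∨
      -(i + j) = i + 5 ∧ 3 - (i + j) = i + 2) ∨
    j = i + 5 ∧ j + 3 = i + 2 ∧ (-(i + j) = i + 1 ∧ 3 - (i + j) = i + 4 ∨
      -(i + j) = i + 4 ∧ 3 - (i + j) = i + 1) := by
    revert i j; decide
  rw [starDiff]
  rcases this with ⟨h1, h2, ⟨h3, h4⟩ | ⟨h3, h4⟩⟩ | ⟨h1, h2, ⟨h3, h4⟩ | ⟨h3, h4⟩⟩ |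
      ⟨h1, h2, ⟨h3, h4⟩ | ⟨h3, h4⟩⟩ | ⟨h1, h2, ⟨h3, h4⟩ | ⟨h3, h4⟩⟩ <;>
    rw [h2, h3, h4, h1] <;> ring

open MvPolynomial in
/-- Quotients of octahedron splines in terms of divided differences. -/
theorem exists_octahedron_quotient_expansion {K : Type*} [Field K]
    {a : Fin 6 → Fin 6 → MvPolynomial (Fin 6) K} {b : Fin 6 → MvPolynomial (Fin 6) K}
    (hab : ∀ i j, octahedronGraph.Adj i j → a i j * (X i - X j) = b i - b j) :
    ∃ c₁ c₂ c₃ c₄ c₅ : MvPolynomial (Fin 6) K, ∃ d : Fin 6 → MvPolynomial (Fin 6) K,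
      ∀ i j, octahedronGraph.Adj i j → a i j = c₁ + c₂ * (X i + X j - X 0 - X 1) +
        c₃ * newtonDiff₃ X i j + c₄ * newtonDiff₄ X i j + c₅ * newtonDiff₅ X i j +
        d i * starDiff X i j + d j * starDiff X j i := by
  obtain ⟨c₀, c₁, c₂, c₃, c₄, c₅, d, h⟩ := exists_octahedron_spline_expansion
    (b := b) fun i j hij => ⟨a i j, by rw [← hab i j hij, mul_comm]⟩
  refine ⟨c₁, c₂, c₃, c₄, c₅, d, fun i j hij => ?_⟩
  have hne : (X i - X j : MvPolynomial (Fin 6) K) ≠ 0 :=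
    sub_ne_zero.mpr fun h => hij.ne (X_injective h)
  apply mul_right_cancel₀ hne
  rw [hab i j hij, h i, h j, ← mul_starDiff X hij, ← mul_starDiff X hij.symm]
  simp only [newtonDiff₅, newtonDiff₄, newtonDiff₃]
  ring

section TestPoint

variable {B : Type*} [CommRing B] {α β γ : B}

/-- Expand in divided differences of powers of `t`. Those of odd degree in `x` cancel along
antipodal edges, where the weights agree and the points are opposite. Degrees 0 and 2 cancel by the
choice of weights and square-zero coordinates. -/
theorem octahedronSum_newtonDiff₃_testPoint (hα : α ^ 2 = 0) (hβ : β ^ 2 = 0)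
    (hγ : γ ^ 2 = 0) :
    octahedronSum (fun i j => newtonDiff₃ (testPoint α β γ) i j * testWeight i j) = 0 := by
  obtain ⟨h1, h2, h3, h4, h5, h6, h7, h8, h9, h10, h11, h12⟩ := testWeight_values (B := B)
  simp only [octahedronSum, h1, h2, h3, h4, h5, h6, h7, h8, h9, h10, h11, h12, newtonDiff₃,
    testPoint, Matrix.cons_val]
  grind

theorem octahedronSum_newtonDiff₄_testPoint (hα : α ^ 2 = 0) (hβ : β ^ 2 = 0)
    (hγ : γ ^ 2 = 0) :
    octahedronSum (fun i j => newtonDiff₄ (testPoint α β γ) i j * testWeight i j) = 0 := by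
  obtain ⟨h1, h2, h3, h4, h5, h6, h7, h8, h9, h10, h11, h12⟩ := testWeight_values (B := B)
  simp only [octahedronSum, h1, h2, h3, h4, h5, h6, h7, h8, h9, h10, h11, h12, newtonDiff₃,
    newtonDiff₄, testPoint, Matrix.cons_val]
  grind

/-- Every term has degree 4 in three square-zero elements, hence vanishes. -/
theorem octahedronSum_newtonDiff₅_testPoint (hα : α ^ 2 = 0) (hβ : β ^ 2 = 0)
    (hγ : γ ^ 2 = 0) :
    octahedronSum (fun i j => newtonDiff₅ (testPoint α β γ) i j * testWeight i j) = 0 := by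
  obtain ⟨h1, h2, h3, h4, h5, h6, h7, h8, h9, h10, h11, h12⟩ := testWeight_values (B := B)
  simp only [octahedronSum, h1, h2, h3, h4, h5, h6, h7, h8, h9, h10, h11, h12, newtonDiff₃,
    newtonDiff₄, newtonDiff₅, testPoint, Matrix.cons_val]
  grind

theorem octahedronSum_starDiff_testPoint (hα : α ^ 2 = 0) (hβ : β ^ 2 = 0)
    (hγ : γ ^ 2 = 0) (d : Fin 6 → B) :
    octahedronSum (fun i j => (d i * starDiff (testPoint α β γ) i j +
      d j * starDiff (testPoint α β γ) j i) * testWeight i j) = 0 := by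
  obtain ⟨h1, h2, h3, h4, h5, h6, h7, h8, h9, h10, h11, h12⟩ := testWeight_values (B := B)
  simp only [octahedronSum, h1, h2, h3, h4, h5, h6, h7, h8, h9, h10, h11, h12, starDiff]
  simp [testPoint]
  grind

end TestPoint

open MvPolynomial in
/-- The test weights annihilate the quotients of all octahedron splines at the test point. -/
theorem octahedronSum_map_testWeight {K B : Type*} [Field K] [CommRing B] {α β γ : B}
    (hα : α ^ 2 = 0) (hβ : β ^ 2 = 0) (hγ : γ ^ 2 = 0)
    (η : MvPolynomial (Fin 6) K →+* B) (hη : ∀ i, η (X i) = testPoint α β γ i)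
    {a : Fin 6 → Fin 6 → MvPolynomial (Fin 6) K} {b : Fin 6 → MvPolynomial (Fin 6) K}
    (hab : ∀ i j, octahedronGraph.Adj i j → a i j * (X i - X j) = b i - b j) :
    octahedronSum (fun i j => η (a i j) * testWeight i j) = 0 := by
  obtain ⟨c₁, c₂, c₃, c₄, c₅, d, h⟩ := exists_octahedron_quotient_expansion hab
  have h' : ∀ i j, octahedronGraph.Adj i j → η (a i j) = η c₁ +
      η c₂ * (testPoint α β γ i + testPoint α β γ j - testPoint α β γ 0 - testPoint α β γ 1) +
      η c₃ * newtonDiff₃ (testPoint α β γ) i j + η c₄ * newtonDiff₄ (testPoint α β γ) i j +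
      η c₅ * newtonDiff₅ (testPoint α β γ) i j +
      (η (d i) * starDiff (testPoint α β γ) i j + η (d j) * starDiff (testPoint α β γ) j i) := by
    intro i j hij
    rw [h i j hij]
    simp only [newtonDiff₅, newtonDiff₄, newtonDiff₃, starDiff, map_add, map_mul, map_sub, hη]
    ring
  have adj : ∀ i j, i ≠ j ∧ i ≠ j + 3 → octahedronGraph.Adj i j := fun i j h => h
  have e₁ : octahedronSum (fun i j => (testWeight i j : B)) = 0 := by
    obtain ⟨h1, h2, h3, h4, h5, h6, h7, h8, h9, h10, h11, h12⟩ := testWeight_values (B := B)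
    simp only [octahedronSum, h1, h2, h3, h4, h5, h6, h7, h8, h9, h10, h11, h12]
    ring
  have e₂ : octahedronSum (fun i j => (testPoint α β γ i + testPoint α β γ j) * testWeight i j) =
      0 := by
    obtain ⟨h1, h2, h3, h4, h5, h6, h7, h8, h9, h10, h11, h12⟩ := testWeight_values (B := B)
    simp only [octahedronSum, h1, h2, h3, h4, h5, h6, h7, h8, h9, h10, h11, h12, testPoint,
      Matrix.cons_val]
    ring
  have e₃ := octahedronSum_newtonDiff₃_testPoint hα hβ hγ
  have e₄ := octahedronSum_newtonDiff₄_testPoint hα hβ hγ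
  have e₅ := octahedronSum_newtonDiff₅_testPoint hα hβ hγ
  have e₆ := octahedronSum_starDiff_testPoint hα hβ hγ fun i => η (d i)
  simp only [octahedronSum] at e₁ e₂ e₃ e₄ e₅ e₆ ⊢
  rw [h' 0 1 (adj _ _ (by decide)), h' 0 2 (adj _ _ (by decide)), h' 0 4 (adj _ _ (by decide)),
    h' 0 5 (adj _ _ (by decide)), h' 1 2 (adj _ _ (by decide)), h' 1 3 (adj _ _ (by decide)),
    h' 1 5 (adj _ _ (by decide)), h' 2 3 (adj _ _ (by decide)), h' 2 4 (adj _ _ (by decide)),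
    h' 3 4 (adj _ _ (by decide)), h' 3 5 (adj _ _ (by decide)), h' 4 5 (adj _ _ (by decide))]
  linear_combination (η c₁ - η c₂ * (testPoint α β γ 0 + testPoint α β γ 1)) * e₁ + η c₂ * e₂ +
    η c₃ * e₃ + η c₄ * e₄ + η c₅ * e₅ + e₆

/-! ### The torsion relation from nine splines. -/

/-- The twelve quotients of an octahedron spline annihilate `s`. -/
def AnnihilatedBySplines {R A : Type*} [CommRing R] [CommRing A] [Algebra R A] (x : Fin 6 → R)
    (s : Fin 6 → Fin 6 → A) : Prop :=
  ∀ (a : Fin 6 → Fin 6 → R) (b : Fin 6 → R),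
    (∀ i j, octahedronGraph.Adj i j → a i j * (x i - x j) = b i - b j) →
      octahedronSum (fun i j => algebraMap R A (a i j) * s i j) = 0

theorem AnnihilatedBySplines.star {R A : Type*} [CommRing R] [CommRing A] [Algebra R A]
    {x : Fin 6 → R} {s : Fin 6 → Fin 6 → A} (h : AnnihilatedBySplines x s) (v : Fin 6) :
    octahedronSum (fun i j =>
      (if i = v then starDiff (fun k => algebraMap R A (x k)) i j
        else if j = v then starDiff (fun k => algebraMap R A (x k)) j i else 0) * s i j) = 0 := by
  have := h (fun i j => if i = v then starDiff x i j else if j = v then starDiff x j i else 0)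
    (fun i => if i = v then (x i - x (i + 1)) * (x i - x (i + 2)) * (x i - x (i + 4)) *
      (x i - x (i + 5)) else 0) ?_
  · convert this using 5
    split_ifs <;> simp [starDiff]
  · intro i j hij
    by_cases hi : i = v
    · have hj : j ≠ v := fun hj => hij.ne (hi.trans hj.symm)
      simp only [hi, hj, if_true, if_false, sub_zero]
      rw [← hi, ← mul_starDiff x hij, mul_comm]
    · by_cases hj : j = v
      · simp only [hi, hj, if_true, if_false, zero_sub]
        rw [← hj, ← mul_starDiff x hij.symm]
        ring
      · simp [hi, hj]

theorem AnnihilatedBySplines.mul_octahedronForm {R A : Type*} [CommRing R] [CommRing A]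
    [Algebra R A] {x : Fin 6 → R} {s : Fin 6 → Fin 6 → A} (h : AnnihilatedBySplines x s) :
    algebraMap R A (2 * (x 0 - x 3)) * octahedronForm (fun i => algebraMap R A (x i)) s = 0 := by
  have t₁ := h (fun _ _ => 1) x fun i j _ => one_mul _
  have t₂ := h (fun i j => x i + x j) (fun i => x i ^ 2) fun i j _ => by ring
  have t₃ := h (fun i j => x i ^ 2 + x i * x j + x j ^ 2) (fun i => x i ^ 3) fun i j _ => by ring
  have g₀ := h.star 0
  have g₁ := h.star 1
  have g₂ := h.star 2
  have g₃ := h.star 3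
  have g₄ := h.star 4
  have g₅ := h.star 5
  simp only [octahedronSum, map_one, one_mul, map_add, map_mul, map_pow] at t₁ t₂ t₃
  have n₁ : (-1 : Fin 6) = 5 := rfl
  have n₂ : (-2 : Fin 6) = 4 := rfl
  have n₃ : (-3 : Fin 6) = 3 := rfl
  have n₄ : (-4 : Fin 6) = 2 := rfl
  have n₅ : (-5 : Fin 6) = 1 := rfl
  simp [octahedronSum, starDiff, n₁, n₂, n₃, n₄, n₅] at g₀ g₁ g₂ g₃ g₄ g₅
  rw [map_mul, map_ofNat, mul_assoc, map_sub, octahedronForm]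
  generalize algebraMap R A (x 0) = x0 at *
  generalize algebraMap R A (x 1) = x1 at *
  generalize algebraMap R A (x 2) = x2 at *
  generalize algebraMap R A (x 3) = x3 at *
  generalize algebraMap R A (x 4) = x4 at *
  generalize algebraMap R A (x 5) = x5 at *
  apply mul_octahedronCubic
  · ring
  · linear_combination t₁
  · linear_combination 2 * t₂ - (x0 + x3 + x1 + x4) * t₁
  · linear_combination 4 * t₃ - 2 * (x0 + x1 + x2 + x3 + x4 + x5) * t₂ +
      ((x0 + x3) * (x1 + x4) + (x0 + x3) * (x2 + x5) + (x1 + x4) * (x2 + x5) -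
        (x0 - x3) ^ 2 - (x1 - x4) ^ 2 - (x2 - x5) ^ 2) * t₁
  -- The coordinates `d, w, p, q, r` are unnormalized sums and differences over antipodal pairs. The
  -- factor 16 collects the resulting powers of 2.
  · linear_combination 16 * g₀
  · linear_combination 16 * g₃
  · linear_combination 16 * g₁
  · linear_combination 16 * g₄
  · linear_combination 16 * g₂
  · linear_combination 16 * g₅

/-- An algebra with three square-zero elements whose product is nonzero. -/
theorem exists_algebra_three_square_zero (K : Type) [Field K] :
    ∃ (B : Type) (_ : CommRing B) (_ : Algebra K B) (α β γ : B),
      α ^ 2 = 0 ∧ β ^ 2 = 0 ∧ γ ^ 2 = 0 ∧ α * β * γ ≠ 0 := by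
  let S : Set (Fin 3 →₀ ℕ) := Set.range fun i => Finsupp.single i 2
  let I : Ideal (MvPolynomial (Fin 3) K) := Ideal.span ((fun m => MvPolynomial.monomial m 1) '' S)
  have hX : ∀ i, Ideal.Quotient.mk I (MvPolynomial.X i) ^ 2 = 0 := by
    intro i
    rw [← map_pow, Ideal.Quotient.eq_zero_iff_mem, MvPolynomial.X_pow_eq_monomial]
    exact Ideal.subset_span ⟨_, ⟨i, rfl⟩, rfl⟩
  refine ⟨MvPolynomial (Fin 3) K ⧸ I, inferInstance, inferInstance, _, _, _, hX 0, hX 1, hX 2, ?_⟩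
  -- Membership in a monomial ideal is tested on exponents, and a squarefree monomial is divisible
  -- by no square of a variable.
  rw [← map_mul, ← map_mul, Ne, Ideal.Quotient.eq_zero_iff_mem]
  have : (MvPolynomial.X 0 * MvPolynomial.X 1 * MvPolynomial.X 2 : MvPolynomial (Fin 3) K) =
      MvPolynomial.monomial (Finsupp.single 0 1 + Finsupp.single 1 1 + Finsupp.single 2 1) 1 := by
    simp [MvPolynomial.X, MvPolynomial.monomial_mul]
  rw [this, MvPolynomial.mem_ideal_span_monomial_image]
  intro h
  obtain ⟨_, ⟨i, rfl⟩, hi⟩ := h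
    (Finsupp.single 0 1 + Finsupp.single 1 1 + Finsupp.single 2 1)
    (by rw [MvPolynomial.mem_support_iff]; simp)
  have := hi i
  fin_cases i <;> simp at this

theorem octahedronSum_congr {A : Type*} [AddCommMonoid A] {s t : Fin 6 → Fin 6 → A}
    (h : ∀ i j, octahedronGraph.Adj i j → s i j = t i j) : octahedronSum s = octahedronSum t := by
  have adj : ∀ i j, i ≠ j ∧ i ≠ j + 3 → s i j = t i j := h
  simp only [octahedronSum]
  rw [adj 0 1 (by decide), adj 0 2 (by decide), adj 0 4 (by decide), adj 0 5 (by decide),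
    adj 1 2 (by decide), adj 1 3 (by decide), adj 1 5 (by decide), adj 2 3 (by decide),
    adj 2 4 (by decide), adj 3 4 (by decide), adj 3 5 (by decide), adj 4 5 (by decide)]

theorem octahedronSum_eq_sum {A : Type*} [AddCommMonoid A] (t : Fin 6 → Fin 6 → A) :
    octahedronSum t =
      ∑ p : Fin 6 × Fin 6 with p.1 < p.2 ∧ p.1 ≠ p.2 + 3, t p.1 p.2 := by
  have : (Finset.univ.filter fun p : Fin 6 × Fin 6 => p.1 < p.2 ∧ p.1 ≠ p.2 + 3) =
      {(0, 1), (0, 2), (0, 4), (0, 5), (1, 2), (1, 3), (1, 5), (2, 3), (2, 4), (3, 4), (3, 5),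
        (4, 5)} := by decide
  rw [this]
  simp [octahedronSum, add_assoc]

/-! ### Absorbing vertex terms into edge variables. -/

/-- The correction of edge variables of the octahedron absorbing vertex terms `c`. -/
def octahedronFlow {A : Type*} [CommRing A] (x c : Fin 6 → A) (i j : Fin 6) : A :=
  if i = 0 ∧ j = 2 then -(x 0 - x 2) * c 2
  else if i = 0 ∧ j = 5 then (x 0 - x 5) * (c 0 + c 2)
  else if j = 5 then (x i - x 5) * c i else 0

/-- The constant spline gives `∑ c i = 0`, so the vertex terms can be moved to vertex 5 along a
spanning tree, each edge turning `b i - b j` into `a i j * (x i - x j)`. Vertex 2 is antipodal to 5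
and goes through 0. -/
theorem annihilatedBySplines_add_flow {R A : Type*} [CommRing R] [CommRing A] [Algebra R A]
    {x : Fin 6 → R} {s : Fin 6 → Fin 6 → A} {c : Fin 6 → A}
    (h : ∀ (a : Fin 6 → Fin 6 → R) (b : Fin 6 → R),
      (∀ i j, octahedronGraph.Adj i j → a i j * (x i - x j) = b i - b j) →
      octahedronSum (fun i j => algebraMap R A (a i j) * s i j) +
        ∑ i, algebraMap R A (b i) * c i = 0) :
    AnnihilatedBySplines x
      (fun i j => s i j + octahedronFlow (fun k => algebraMap R A (x k)) c i j) := by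
  intro a b hab
  have hc := h (fun _ _ => 0) (fun _ => 1) (by simp)
  have hs := h a b hab
  have e : ∀ i j, i ≠ j ∧ i ≠ j + 3 → algebraMap R A (a i j) *
      (algebraMap R A (x i) - algebraMap R A (x j)) =
      algebraMap R A (b i) - algebraMap R A (b j) := by
    intro i j hij
    rw [← map_sub, ← map_mul, hab i j hij, map_sub]
  have e05 := e 0 5 (by decide)
  have e02 := e 0 2 (by decide)
  have e15 := e 1 5 (by decide)
  have e35 := e 3 5 (by decide)
  have e45 := e 4 5 (by decide)
  simp [octahedronSum, Fin.sum_univ_six] at hc hs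
  simp [octahedronSum, octahedronFlow]
  linear_combination hs - algebraMap R A (b 5) * hc + (c 0 + c 2) * e05 - c 2 * e02 + c 1 * e15 +
    c 3 * e35 + c 4 * e45

/-! ### Logarithmic derivations of graphic arrangements as splines. -/

section Graphic

open MvPolynomial

theorem mem_logDerModule {ι σ : Type*} [Fintype ι] [DecidableEq ι] [Fintype σ]
    {f : ι → MvPolynomial σ ℂ} {a : ι → MvPolynomial σ ℂ} :
    a ∈ logDerModule f ↔
      ∃ b : σ → MvPolynomial σ ℂ, ∀ e, f e * a e + ∑ k, pderiv k (f e) * b k = 0 := by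
  simp only [logDerModule, Submodule.mem_map, LinearMap.mem_ker, Matrix.mulVecLin_apply,
    arrangementMatrix]
  constructor
  · rintro ⟨v, hv, rfl⟩
    refine ⟨fun k => v (Sum.inr k), fun e => ?_⟩
    have := congrFun hv e
    rw [Matrix.fromCols_mulVec] at this
    simpa [Matrix.mulVec_diagonal, Matrix.mulVec, dotProduct, LinearMap.funLeft, Matrix.diagonal_apply] using this
  · rintro ⟨b, hb⟩
    refine ⟨Sum.elim a b, ?_, by ext; simp [LinearMap.funLeft]⟩
    ext1 e
    rw [Matrix.fromCols_mulVec]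
    simpa [Matrix.mulVec, dotProduct, Matrix.diagonal_apply] using hb e

variable {n : ℕ} {G : SimpleGraph (Fin n)}

/-- The derivative of `x_i - x_j` along `b` is `b_i - b_j`. Moving it across the equation reverses
its sign. -/
theorem mem_logDerModule_graphicArrangement [Fintype G.edgeSet] [DecidableEq G.edgeSet]
    {a : G.edgeSet → MvPolynomial (Fin n) ℂ} :
    a ∈ logDerModule (graphicArrangement G) ↔ ∃ b : Fin n → MvPolynomial (Fin n) ℂ,
      ∀ e, a e * graphicArrangement G e = b e.1.sup - b e.1.inf := by
  rw [mem_logDerModule]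
  refine exists_congr fun b => forall_congr' fun e => ?_
  have : ∑ k, pderiv k (graphicArrangement G e) * b k = b e.1.inf - b e.1.sup := by
    simp [graphicArrangement, pderiv_X, Pi.single_apply, sub_mul, Finset.sum_sub_distrib]
  rw [this]
  constructor <;> intro h <;> linear_combination h

theorem graphicArrangement_mk {u v : Fin n} (h : s(u, v) ∈ G.edgeSet) :
    (graphicArrangement G ⟨s(u, v), h⟩ = X u - X v ∧ s(u, v).inf = u ∧ s(u, v).sup = v) ∨
    (graphicArrangement G ⟨s(u, v), h⟩ = X v - X u ∧ s(u, v).inf = v ∧ s(u, v).sup = u) := by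
  rcases le_total u v with huv | huv
  · left; simp [graphicArrangement, huv]
  · right; simp [graphicArrangement, huv]

theorem graphicArrangement_ne_zero (e : G.edgeSet) : graphicArrangement G e ≠ 0 := by
  obtain ⟨e, he⟩ := e
  induction e using Sym2.ind with
  | _ u v =>
    have huv : u ≠ v := G.ne_of_adj he
    rcases graphicArrangement_mk he with ⟨h, -⟩ | ⟨h, -⟩ <;> rw [h, sub_ne_zero] <;>
      intro h' <;> have := X_injective h' <;> tauto

theorem mul_graphicArrangement_iff {u v : Fin n} (h : s(u, v) ∈ G.edgeSet)
    {a : MvPolynomial (Fin n) ℂ} {b : Fin n → MvPolynomial (Fin n) ℂ} :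
    a * graphicArrangement G ⟨s(u, v), h⟩ = b s(u, v).sup - b s(u, v).inf ↔
      -a * (X u - X v) = b u - b v := by
  rcases graphicArrangement_mk h with ⟨h₁, h₂, h₃⟩ | ⟨h₁, h₂, h₃⟩ <;> rw [h₁, h₂, h₃] <;>
    constructor <;> intro h <;>
    first | linear_combination h | linear_combination -h

end Graphic

/-! ### Generators and relations of the symmetric algebra. -/

section Likelihood

variable {ι σ : Type*} [Fintype ι] [DecidableEq ι] [Fintype σ] (f : ι → MvPolynomial σ ℂ)

/-- The generators of the symmetric algebra of the likelihood module. -/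
noncomputable def likelihoodGen (e : ι) :
    SymmetricAlgebra (MvPolynomial σ ℂ) (LikelihoodModule f) :=
  SymmetricAlgebra.ι _ _ ((logDerModule f).mkQ (Pi.single e 1))

theorem sum_smul_likelihoodGen {a : ι → MvPolynomial σ ℂ} (ha : a ∈ logDerModule f) :
    ∑ e, algebraMap _ (SymmetricAlgebra (MvPolynomial σ ℂ) (LikelihoodModule f)) (a e) *
      likelihoodGen f e = 0 := by
  have h : (logDerModule f).mkQ (∑ e, a e • Pi.single e (1 : MvPolynomial σ ℂ)) = 0 := by
    rw [Submodule.mkQ_apply, Submodule.Quotient.mk_eq_zero]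
    convert ha
    ext1 e
    simp [Finset.sum_apply, Pi.single_apply]
  have := congrArg (SymmetricAlgebra.ι (MvPolynomial σ ℂ) (LikelihoodModule f)) h
  simp only [map_sum, map_smul, map_zero] at this
  simpa only [likelihoodGen, Algebra.smul_def] using this

theorem exists_likelihood_hom {B : Type*} [CommRing B] [Algebra (MvPolynomial σ ℂ) B] (s : ι → B)
    (hs : ∀ a ∈ logDerModule f, ∑ e, algebraMap _ B (a e) * s e = 0) :
    ∃ φ : SymmetricAlgebra (MvPolynomial σ ℂ) (LikelihoodModule f) →ₐ[MvPolynomial σ ℂ] B,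
      ∀ e, φ (likelihoodGen f e) = s e := by
  refine ⟨SymmetricAlgebra.lift ((logDerModule f).liftQ
    (Fintype.linearCombination (MvPolynomial σ ℂ) s) ?_), fun e => ?_⟩
  · intro a ha
    rw [LinearMap.mem_ker, Fintype.linearCombination_apply]
    simpa only [Algebra.smul_def] using hs a ha
  · rw [likelihoodGen, SymmetricAlgebra.lift_ι_apply, Submodule.mkQ_apply, Submodule.liftQ_apply,
      Fintype.linearCombination_apply_single, one_smul]

theorem eq_zero_of_isGentle {f : ι → MvPolynomial σ ℂ} (hf : IsGentle f)
    {r : MvPolynomial σ ℂ} (hr : r ≠ 0)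
    {z : SymmetricAlgebra (MvPolynomial σ ℂ) (LikelihoodModule f)}
    (h : algebraMap _ _ r * z = 0) : z = 0 := by
  apply hf.1
  rw [map_zero, Ideal.Quotient.eq_zero_iff_mem, mem_symTorsionIdeal]
  exact ⟨r, mem_nonZeroDivisors_of_ne_zero hr, by rw [Algebra.smul_def, h]⟩

end Likelihood

theorem octahedronSum_neg {A : Type*} [AddCommGroup A] (t : Fin 6 → Fin 6 → A) :
    octahedronSum (fun i j => -t i j) = -octahedronSum t := by
  simp only [octahedronSum]
  abel

theorem octahedronForm_congr {A : Type*} [CommRing A] (x : Fin 6 → A) {s t : Fin 6 → Fin 6 → A}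
    (h : ∀ i j, octahedronGraph.Adj i j → s i j = t i j) :
    octahedronForm x s = octahedronForm x t := by
  have adj : ∀ i j, i ≠ j ∧ i ≠ j + 3 → s i j = t i j := h
  simp only [octahedronForm]
  rw [adj 0 1 (by decide), adj 0 2 (by decide), adj 0 4 (by decide), adj 0 5 (by decide),
    adj 1 2 (by decide), adj 1 3 (by decide), adj 1 5 (by decide), adj 2 3 (by decide),
    adj 2 4 (by decide), adj 3 4 (by decide), adj 3 5 (by decide), adj 4 5 (by decide)]

theorem isNilpotent_testPoint {B : Type*} [CommRing B] {α β γ : B} (hα : α ^ 2 = 0)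
    (hβ : β ^ 2 = 0) (hγ : γ ^ 2 = 0) (i : Fin 6) : IsNilpotent (testPoint α β γ i) := by
  have ha : α ∈ nilradical B := ⟨2, hα⟩
  have hb : β ∈ nilradical B := ⟨2, hβ⟩
  have hc : γ ∈ nilradical B := ⟨2, hγ⟩
  rw [← mem_nilradical]
  fin_cases i
  · exact sub_mem ha hb
  · exact add_mem ha hb
  · exact hc
  · exact sub_mem hb ha
  · exact sub_mem (neg_mem ha) hb
  · exact neg_mem hc

/-! ### The octahedron inside a larger graph. -/

section InducedOctahedron

open MvPolynomial

variable {n : ℕ} {G : SimpleGraph (Fin n)} (f : octahedronGraph ↪g G)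

/-- The edges of the induced octahedron. -/
def octahedronEdges : Set G.edgeSet := {e | ∃ i j, e.1 = s(f i, f j)}

/-- Extension by zero of a family indexed by the edges. -/
noncomputable def extendEdges {A : Type*} [Zero A] (t : G.edgeSet → A) (z : Sym2 (Fin n)) : A :=
  open Classical in if h : z ∈ G.edgeSet then t ⟨z, h⟩ else 0

theorem extendEdges_of_mem {A : Type*} [Zero A] (t : G.edgeSet → A) {z : Sym2 (Fin n)}
    (h : z ∈ G.edgeSet) : extendEdges t z = t ⟨z, h⟩ := by
  simp [extendEdges, h]

/-- Inducedness enters through this equivalence: no further edge of `G` joins vertices of the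
octahedron. -/
theorem mk_mem_edgeSet_iff {i j : Fin 6} : s(f i, f j) ∈ G.edgeSet ↔ octahedronGraph.Adj i j := by
  simp

open Classical in
theorem sum_octahedronEdges [Fintype G.edgeSet] {A : Type*} [AddCommMonoid A]
    (t : G.edgeSet → A) :
    ∑ e with e ∈ octahedronEdges f, t e =
      octahedronSum fun i j => extendEdges t s(f i, f j) := by
  have hadj : ∀ i j : Fin 6, octahedronGraph.Adj i j ↔ i ≠ j ∧ i ≠ j + 3 := fun _ _ => Iff.rfl
  rw [octahedronSum_eq_sum]
  symm
  refine Finset.sum_bij (fun p hp => ⟨s(f p.1, f p.2), (mk_mem_edgeSet_iff f).2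
    ((hadj _ _).2 ⟨(Finset.mem_filter.1 hp).2.1.ne, (Finset.mem_filter.1 hp).2.2⟩)⟩) ?_ ?_ ?_ ?_
  · intro p hp
    simp only [Finset.mem_filter, Finset.mem_univ, true_and]
    exact ⟨p.1, p.2, rfl⟩
  · intro p hp q hq h
    have hp' := (Finset.mem_filter.1 hp).2.1
    have hq' := (Finset.mem_filter.1 hq).2.1
    rw [Subtype.mk.injEq, Sym2.eq_iff] at h
    rcases h with ⟨h1, h2⟩ | ⟨h1, h2⟩
    · exact Prod.ext (f.injective h1) (f.injective h2)
    · rw [f.injective h1, f.injective h2] at hp'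
      exact absurd hp' hq'.not_gt
  · rintro ⟨e, he⟩ h
    obtain ⟨i, j, hij⟩ := (Finset.mem_filter.1 h).2
    simp only at hij
    subst hij
    have hij := (hadj _ _).1 ((mk_mem_edgeSet_iff f).1 he)
    rcases lt_or_gt_of_ne hij.1 with hlt | hlt
    · exact ⟨(i, j), by simp [hlt, hij.2], rfl⟩
    · refine ⟨(j, i), ?_, by simp [Sym2.eq_swap]⟩
      have h3 := ((hadj _ _).1 ((mk_mem_edgeSet_iff f).1 he).symm).2
      simp [hlt, h3]
  · intro p hp
    rw [extendEdges_of_mem]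

/-- The product of the linear forms of the edges outside the octahedron. -/
noncomputable def outerProduct [Fintype G.edgeSet] : MvPolynomial (Fin n) ℂ :=
  open Classical in ∏ e with e ∉ octahedronEdges f, graphicArrangement G e

/-- The product of the linear forms of the edges outside the octahedron and different from `e`. -/
noncomputable def outerCofactor [Fintype G.edgeSet] (e : G.edgeSet) : MvPolynomial (Fin n) ℂ :=
  open Classical in
  ∏ e' ∈ (Finset.univ.filter fun e' => e' ∉ octahedronEdges f).erase e, graphicArrangement G e'

theorem outerCofactor_mul [Fintype G.edgeSet] {e : G.edgeSet} (he : e ∉ octahedronEdges f) :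
    outerCofactor f e * graphicArrangement G e = outerProduct f := by
  classical
  exact Finset.prod_erase_mul _ _ (by simpa using he)

/-- Splines on the octahedron yield logarithmic derivations of the graphic arrangement. -/
theorem exists_logDer_of_octahedron_spline [Fintype G.edgeSet] [DecidableEq G.edgeSet]
    {a : Fin 6 → Fin 6 → MvPolynomial (Fin n) ℂ} {b : Fin 6 → MvPolynomial (Fin n) ℂ}
    (hab : ∀ i j, octahedronGraph.Adj i j →
      a i j * (X (f i) - X (f j)) = b i - b j) :
    ∃ a' ∈ logDerModule (graphicArrangement G),
      (∀ i j, ∀ h : s(f i, f j) ∈ G.edgeSet, a' ⟨s(f i, f j), h⟩ = outerProduct f * a i j) ∧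
      ∀ e ∉ octahedronEdges f, a' e = outerCofactor f e *
        ∑ i, b i * ((if f i = e.1.inf then 1 else 0) - if f i = e.1.sup then 1 else 0) := by
  -- Extend by zero off the octahedron. The factor `outerProduct f` makes the differences divisible
  -- along outer edges, and its minus sign matches the orientation `sup - inf`.
  set b' : Fin n → MvPolynomial (Fin n) ℂ := fun v => ∑ i, if f i = v then b i else 0 with hb'
  have hb'f : ∀ i, b' (f i) = b i := by
    intro i
    simp [hb', f.injective.eq_iff]
  have key : ∀ e : G.edgeSet, ∃ c : MvPolynomial (Fin n) ℂ,
      c * graphicArrangement G e = -outerProduct f * b' e.1.sup - -outerProduct f * b' e.1.inf ∧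
      (e ∉ octahedronEdges f → c = outerCofactor f e *
        ∑ i, b i * ((if f i = e.1.inf then 1 else 0) - if f i = e.1.sup then 1 else 0)) := by
    intro e
    by_cases he : e ∈ octahedronEdges f
    · obtain ⟨e, h⟩ := e
      obtain ⟨i, j, hij⟩ := id he
      simp only at hij
      subst hij
      refine ⟨outerProduct f * a i j, ?_, fun h' => absurd he h'⟩
      refine (mul_graphicArrangement_iff (b := fun v => -outerProduct f * b' v) h).2 ?_
      rw [hb'f, hb'f]
      linear_combination -outerProduct f * hab i j ((mk_mem_edgeSet_iff f).1 h)
    · refine ⟨_, ?_, fun _ => rfl⟩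
      have : ∑ i, b i * ((if f i = e.1.inf then 1 else 0) - if f i = e.1.sup then 1 else 0) =
          b' e.1.inf - b' e.1.sup := by
        simp [hb', mul_sub, Finset.sum_sub_distrib]
      rw [this, ← outerCofactor_mul f he]
      ring
  choose a' h1 h2 using key
  refine ⟨a', mem_logDerModule_graphicArrangement.2 ⟨fun v => -outerProduct f * b' v, h1⟩, ?_, h2⟩
  intro i j h
  apply mul_right_cancel₀ (graphicArrangement_ne_zero ⟨_, h⟩)
  rw [h1]
  symm
  refine (mul_graphicArrangement_iff (b := fun v => -outerProduct f * b' v) h).2 ?_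
  rw [hb'f, hb'f]
  linear_combination -outerProduct f * hab i j ((mk_mem_edgeSet_iff f).1 h)

/-- The vertex terms coming from the edges outside the octahedron. -/
noncomputable def outerTerm [Fintype G.edgeSet] {A : Type*} [CommRing A]
    [Algebra (MvPolynomial (Fin n) ℂ) A] (t : G.edgeSet → A) (i : Fin 6) : A :=
  open Classical in ∑ e with e ∉ octahedronEdges f,
    algebraMap _ A (outerCofactor f e *
      ((if f i = e.1.inf then 1 else 0) - if f i = e.1.sup then 1 else 0)) * t e

theorem octahedronSum_add_outerTerm [Fintype G.edgeSet] [DecidableEq G.edgeSet]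
    {A : Type*} [CommRing A] [Algebra (MvPolynomial (Fin n) ℂ) A] {t : G.edgeSet → A}
    (ht : ∀ a ∈ logDerModule (graphicArrangement G), ∑ e, algebraMap _ A (a e) * t e = 0)
    {a : Fin 6 → Fin 6 → MvPolynomial (Fin n) ℂ} {b : Fin 6 → MvPolynomial (Fin n) ℂ}
    (hab : ∀ i j, octahedronGraph.Adj i j →
      a i j * (X (f i) - X (f j)) = b i - b j) :
    octahedronSum (fun i j => algebraMap _ A (a i j) *
      (algebraMap _ A (outerProduct f) * extendEdges t s(f i, f j))) +
      ∑ i, algebraMap _ A (b i) * outerTerm f t i = 0 := by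
  classical
  obtain ⟨a', ha', h1, h2⟩ := exists_logDer_of_octahedron_spline f hab
  rw [← ht a' ha', ← Finset.sum_filter_add_sum_filter_not _ (· ∈ octahedronEdges f),
    sum_octahedronEdges]
  congr 1
  · apply octahedronSum_congr
    intro i j hij
    have h := (mk_mem_edgeSet_iff f).2 hij
    rw [extendEdges_of_mem _ h, extendEdges_of_mem _ h, h1, map_mul]
    ring
  · simp only [outerTerm, Finset.mul_sum]
    rw [Finset.sum_comm]
    refine Finset.sum_congr rfl fun e he => ?_
    rw [h2 e (Finset.mem_filter.1 he).2, Finset.mul_sum, map_sum, Finset.sum_mul]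
    refine Finset.sum_congr rfl fun i _ => ?_
    simp only [map_mul]
    ring

/-- Restriction to the vertices of the octahedron, the other variables being specialized to
distinct nonzero constants. -/
noncomputable def restrictOctahedron : MvPolynomial (Fin n) ℂ →ₐ[ℂ] MvPolynomial (Fin 6) ℂ :=
  open Classical in aeval fun v => if h : ∃ i, f i = v then X h.choose else C ((v : ℂ) + 1)

theorem restrictOctahedron_X (i : Fin 6) : restrictOctahedron f (X (f i)) = X i := by
  have h : ∃ j, f j = f i := ⟨i, rfl⟩
  rw [restrictOctahedron, aeval_X, dif_pos h, f.injective h.choose_spec]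

theorem restrictOctahedron_X_of_notMem {v : Fin n} (h : v ∉ Set.range f) :
    restrictOctahedron f (X v) = C ((v : ℂ) + 1) := by
  rw [restrictOctahedron, aeval_X]
  exact dif_neg h

/-- Modulo nilpotents, octahedral vertices go to 0 and the others to distinct nonzero constants. An
outer edge has an endpoint off the octahedron, so its form becomes a nonzero constant plus a
nilpotent. -/
theorem isUnit_map_graphicArrangement {B : Type*} [CommRing B] [Algebra ℂ B]
    (η : MvPolynomial (Fin 6) ℂ →ₐ[ℂ] B) (hη : ∀ i, IsNilpotent (η (X i))) {e : G.edgeSet}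
    (he : e ∉ octahedronEdges f) :
    IsUnit (η (restrictOctahedron f (graphicArrangement G e))) := by
  obtain ⟨e, h⟩ := e
  induction e using Sym2.ind with
  | _ u v =>
    have huv : u ≠ v := G.ne_of_adj h
    have hrange : ∀ v, ∃ c : ℂ, ∃ m : B, IsNilpotent m ∧
        η (restrictOctahedron f (X v)) = algebraMap ℂ B c + m ∧
        c = if v ∈ Set.range f then 0 else (v : ℂ) + 1 := by
      intro v
      by_cases hv : v ∈ Set.range f
      · obtain ⟨i, rfl⟩ := hv
        exact ⟨0, η (X i), hη i, by simp [restrictOctahedron_X], by simp⟩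
      · refine ⟨(v : ℂ) + 1, 0, IsNilpotent.zero, ?_, by simp [hv]⟩
        rw [restrictOctahedron_X_of_notMem f hv, ← algebraMap_eq, AlgHom.commutes, add_zero]
    obtain ⟨c, m, hm, hu, hc⟩ := hrange u
    obtain ⟨c', m', hm', hv, hc'⟩ := hrange v
    have hne : c - c' ≠ 0 := by
      rw [sub_ne_zero, hc, hc']
      have pos : ∀ w : Fin n, (w : ℂ) + 1 ≠ 0 := fun w => Nat.cast_add_one_ne_zero _
      split_ifs with h1 h2 h2
      · obtain ⟨i, rfl⟩ := h1
        obtain ⟨j, rfl⟩ := h2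
        exact absurd ⟨i, j, rfl⟩ he
      · exact (pos v).symm
      · exact pos u
      · intro h
        exact huv (Fin.ext (by exact_mod_cast add_right_cancel h))
    have hsub : IsUnit (η (restrictOctahedron f (X u - X v))) := by
      have : η (restrictOctahedron f (X u - X v)) = algebraMap ℂ B (c - c') + (m - m') := by
        rw [map_sub, map_sub, hu, hv, map_sub]
        ring
      rw [this]
      exact ((Commute.all m m').isNilpotent_sub hm hm').isUnit_add_left_of_commute
        ((IsUnit.mk0 _ hne).map (algebraMap ℂ B)) (Commute.all _ _)
    rcases graphicArrangement_mk h with ⟨h', -⟩ | ⟨h', -⟩ <;> rw [h']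
    · exact hsub
    · rw [← neg_sub, map_neg, map_neg]
      exact hsub.neg

/-- The weights of the test point on the edges of the octahedron, extended by zero. -/
theorem exists_testWeight_extension (B : Type*) [CommRing B] :
    ∃ s : G.edgeSet → B, (∀ i j, ∀ h : s(f i, f j) ∈ G.edgeSet,
      s ⟨s(f i, f j), h⟩ = testWeight i j) ∧ ∀ e ∉ octahedronEdges f, s e = 0 := by
  have symm : ∀ i j, (testWeight i j : B) = testWeight j i := by
    intro i j
    simp only [testWeight, iff_comm (a := i < 3)]
    congr 1
    simp only [eq_iff_iff]
    tauto
  have key : ∀ e : G.edgeSet, ∃ c : B, (∀ i j, e.1 = s(f i, f j) → c = testWeight i j) ∧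
      (e ∉ octahedronEdges f → c = 0) := by
    intro e
    by_cases he : e ∈ octahedronEdges f
    · obtain ⟨i, j, hij⟩ := id he
      refine ⟨testWeight i j, fun k l hkl => ?_, fun h => absurd he h⟩
      rw [hij, Sym2.eq_iff] at hkl
      rcases hkl with ⟨h1, h2⟩ | ⟨h1, h2⟩
      · rw [f.injective h1, f.injective h2]
      · rw [f.injective h1, f.injective h2, symm]
    · exact ⟨0, fun i j h => absurd ⟨i, j, h⟩ he, fun _ => rfl⟩
  choose s h1 h2 using key
  exact ⟨s, fun i j h => h1 _ i j rfl, h2⟩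

/-- A graphic arrangement containing an induced octahedron is not gentle. -/
theorem not_isGentle_of_octahedron_embedding [Fintype G.edgeSet] [DecidableEq G.edgeSet]
    (f : octahedronGraph ↪g G) :
    ¬ IsGentle (graphicArrangement G) := by
  classical
  intro hG
  obtain ⟨B, _, _, α, β, γ, hα, hβ, hγ, hne⟩ := exists_algebra_three_square_zero ℂ
  let η : MvPolynomial (Fin 6) ℂ →ₐ[ℂ] B := aeval (testPoint α β γ)
  have hη : ∀ i, η (X i) = testPoint α β γ i := fun i => aeval_X _ i
  let ev : MvPolynomial (Fin n) ℂ →+* B := (η.comp (restrictOctahedron f)).toRingHom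
  let _ : Algebra (MvPolynomial (Fin n) ℂ) B := ev.toAlgebra
  have hev : ∀ p, algebraMap (MvPolynomial (Fin n) ℂ) B p = η (restrictOctahedron f p) :=
    fun _ => rfl
  obtain ⟨s, hs, hs'⟩ := exists_testWeight_extension f B
  obtain ⟨φ, hφ⟩ := exists_likelihood_hom (graphicArrangement G) s (by
    intro a ha
    obtain ⟨b, hb⟩ := mem_logDerModule_graphicArrangement.1 ha
    rw [← Finset.sum_filter_add_sum_filter_not _ (· ∈ octahedronEdges f), sum_octahedronEdges,
      Finset.sum_eq_zero (s := Finset.filter _ _), add_zero]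
    -- Outer edges have weight 0, and what remains is the restriction of a spline on `G` to the
    -- octahedron.
    · have := octahedronSum_map_testWeight hα hβ hγ η.toRingHom hη
        (a := fun i j => restrictOctahedron f (-extendEdges a s(f i, f j)))
        (b := fun i => restrictOctahedron f (b (f i))) ?_
      · rw [← neg_eq_zero, ← this, ← octahedronSum_neg]
        refine octahedronSum_congr fun i j hij => ?_
        have h := (mk_mem_edgeSet_iff f).2 hij
        rw [extendEdges_of_mem _ h, extendEdges_of_mem _ h, hs, hev, map_neg, ← neg_mul]
        exact congrArg (· * _) (map_neg η _).symm
      · intro i j hij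
        have h := (mk_mem_edgeSet_iff f).2 hij
        rw [extendEdges_of_mem _ h, ← restrictOctahedron_X f, ← restrictOctahedron_X f, ← map_sub,
          ← map_mul, (mul_graphicArrangement_iff h).1 (hb ⟨_, h⟩), map_sub]
    · intro e he
      rw [hs' e (Finset.mem_filter.1 he).2, mul_zero])
  have hann := annihilatedBySplines_add_flow (x := fun i => X (f i))
    (fun a b hab => octahedronSum_add_outerTerm f
      (fun a ha => sum_smul_likelihoodGen (graphicArrangement G) ha) hab)
  -- Absence of torsion forces the cubic in the corrected edge variables to vanish. Its image under
  -- `φ` will contradict this.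
  have hz := eq_zero_of_isGentle hG ?_ hann.mul_octahedronForm
  · have hφX : ∀ p, φ (algebraMap _ _ p) = η (restrictOctahedron f p) := fun p => φ.commutes p
    have houter : ∀ i, φ (outerTerm f (likelihoodGen (graphicArrangement G)) i) = 0 := by
      intro i
      rw [outerTerm, map_sum]
      refine Finset.sum_eq_zero fun e he => ?_
      rw [map_mul, hφ, hs' e (Finset.mem_filter.1 he).2, mul_zero]
    have hform := congrArg φ.toRingHom hz
    rw [map_octahedronForm, map_zero, octahedronForm_congr
      (t := fun i j => η (restrictOctahedron f (outerProduct f)) * testWeight i j)] at hform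
    · have hx : (fun i => φ.toRingHom (algebraMap (MvPolynomial (Fin n) ℂ) _ (X (f i)))) =
          testPoint α β γ := by
        funext i
        exact (hφX _).trans (by rw [restrictOctahedron_X, hη])
      rw [hx, octahedronForm_mul, octahedronForm_testPoint] at hform
      have hD : IsUnit (η (restrictOctahedron f (outerProduct f))) := by
        rw [outerProduct, map_prod, map_prod]
        refine IsUnit.prod_iff.2 fun e he => isUnit_map_graphicArrangement f η ?_
          (Finset.mem_filter.1 he).2
        intro i
        rw [hη]
        exact isNilpotent_testPoint hα hβ hγ i
      have h2 : IsUnit (2048 : B) := by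
        have := (IsUnit.mk0 (2048 : ℂ) (by norm_num)).map (algebraMap ℂ B)
        rwa [map_ofNat] at this
      -- The image is `D ^ 3 * (2048 * (α * β * γ))`, with `D` the image of the outer product. Both
      -- `D` and 2048 are units.
      exact hne ((h2.mul_right_eq_zero).1 (((hD.pow 3).mul_right_eq_zero).1 hform))
    · intro i j hij
      have h := (mk_mem_edgeSet_iff f).2 hij
      change φ _ = _
      rw [map_add, map_mul, hφX, extendEdges_of_mem _ h, hφ, hs]
      -- The correction is built from outer edge variables, all killed by `φ`.
      have : φ (octahedronFlow (fun k => algebraMap (MvPolynomial (Fin n) ℂ) _ (X (f k)))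
          (outerTerm f (likelihoodGen (graphicArrangement G))) i j) = 0 := by
        simp only [octahedronFlow]
        split_ifs <;> simp [houter]
      rw [this, add_zero]
  · refine mul_ne_zero two_ne_zero (sub_ne_zero.2 fun h => ?_)
    exact absurd (f.injective (X_injective h)) (by decide)

end InducedOctahedron

theorem mainTheorem9 (n : ℕ) (G : SimpleGraph (Fin n)) [DecidableRel G.Adj]
    (hG : SimpleGraph.IsIndContained octahedronGraph G) :
    ¬ IsGentle (graphicArrangement G) := by
  obtain ⟨f⟩ := hG
  exact not_isGentle_of_octahedron_embedding f
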